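/- Let $\mathbb D$ be the open unit disk, $D_s=\{z\in\mathbb C:|z|<s\}$, $q\in\mathbb C$ with $\Re q>0$, and $r>0$. Let $\mathcal A_r$ be the class of all holomorphic functions $F$ on $\mathbb D$ with $F(0)=0$, $F'(0)=1+rq$ and $$\Re\,\frac1{2r\Re q}\left(\frac{F(z)}z-(1+rq)\right)>-\frac12\qquad(z\in\mathbb D)$$ (with $F(z)/z:=F'(0)$ at $z=0$); equivalently, $F=\mathrm{Id}+rf$ with $f$ holomorphic on $\mathbb D$, $f(0)=0$, $f'(0)=q$ and $\Re (f(z)/z)>0$. For every $F\in\mathcal A_r$ and every $w\in\mathbb D$ the equation $F(z)=w$ has exactly one solution $z=:G_r(w)$ in $\mathbb D$, and $G_r=F^{-1}=(\mathrm{Id}+rf)^{-1}$ is a holomorphic self-mapping of $\mathbb D$ (the nonlinear resolvent of $f$). Let $\mathcal J_r$ be the family of all these functions $G_r$. Then every $G_r\in\mathcal J_r$ has the following properties. (a) If $r>2/\Re q$, then $\rho(r):=\left(\sqrt{2r\Re q}-\sqrt{r\Re q-1}\right)^2>1$, and $G_r$ extends to a univalent (holomorphic and injective) function on $D_{\rho(r)}$,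 again denoted by $G_r$, such that $G_r(D_{\rho(r)})\subset D_{\rho_1(r)}$ with $\rho_1(r)=\sqrt{\dfrac{2r\Re q}{r\Re q-1}}-1$. (b) If $r>2/\Re q$, then this extension satisfies $G_r(D_{\rho(r)})\supset D_{\rho_2(r)}$ with $$\rho_2(r)=\frac{\left(\sqrt{2r\Re q}-\sqrt{r\Re q-1}\right)^2}{|1+rq|+\sqrt{2+r\Re q+r^2|q|^2}}.$$ (c) For every $r>0$, $G_r(\mathbb D)\supset D_{\rho_3(r)}$ with $\rho_3(r)=\dfrac1{|1+rq|+\sqrt{|1+rq|^2-1}}$. -/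

import Mathlib

/-- The class `𝒜_{α,β}` of functions `F` holomorphic in the open unit disk with `F(0) = 0`,
`F'(0) = β` and `Re ((F(z)/z - β)/α) > -1/2`. At `z = 0` the quotient `F(z)/z` has the removable
value `F'(0) = β`, so the inequality holds there automatically. -/
def classA (α β : ℂ) : Set (ℂ → ℂ) :=
  {F | DifferentiableOn ℂ F (Metric.ball 0 1) ∧ F 0 = 0 ∧ deriv F 0 = β ∧
    ∀ z ∈ Metric.ball (0 : ℂ) 1, z ≠ 0 → -(1 / 2 : ℝ) < (1 / α * (F z / z - β)).re}

/-- The family `𝒥_r` (for fixed `q`) of the resolvents `G_r = F⁻¹ = (Id + r f)⁻¹`, where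
`F = Id + r f` runs over `𝒜_{2 r Re q, 1 + r q}`: `G` is a self-mapping of the open unit disk
and `F (G w) = w`, that is, `G w + r f (G w) = w`, on it.
Values of `G` outside the open unit disk are irrelevant. -/
def classJ (q : ℂ) (r : ℝ) : Set (ℂ → ℂ) :=
  {G | ∃ F ∈ classA ((2 * r * q.re : ℝ) : ℂ) (1 + r * q),
    ∀ w ∈ Metric.ball (0 : ℂ) 1, G w ∈ Metric.ball (0 : ℂ) 1 ∧ F (G w) = w}

/-- `ρ(r) = (√(2 r Re q) - √(r Re q - 1))²`. -/
noncomputable def rho (q : ℂ) (r : ℝ) : ℝ :=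
  (Real.sqrt (2 * r * q.re) - Real.sqrt (r * q.re - 1)) ^ 2

/-- `ρ₁(r) = √(2 r Re q / (r Re q - 1)) - 1`. -/
noncomputable def rhoOne (q : ℂ) (r : ℝ) : ℝ :=
  Real.sqrt (2 * r * q.re / (r * q.re - 1)) - 1

/-- `ρ₂(r) = (√(2 r Re q) - √(r Re q - 1))² / (|1 + r q| + √(2 + r Re q + r² |q|²))`. -/
noncomputable def rhoTwo (q : ℂ) (r : ℝ) : ℝ :=
  (Real.sqrt (2 * r * q.re) - Real.sqrt (r * q.re - 1)) ^ 2 /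
    (‖1 + (r : ℂ) * q‖ + Real.sqrt (2 + r * q.re + r ^ 2 * ‖q‖ ^ 2))

/-- `ρ₃(r) = 1 / (|1 + r q| + √(|1 + r q|² - 1))`. -/
noncomputable def rhoThree (q : ℂ) (r : ℝ) : ℝ :=
  1 / (‖1 + (r : ℂ) * q‖ + Real.sqrt (‖1 + (r : ℂ) * q‖ ^ 2 - 1))

/-!
Put `m = r Re q` and `β = 1 + r q`, so that `Re β = 1 + m`. A function `F` of the class has the
form `F z = z (β + u z)` with `u` holomorphic on the unit disk, `u 0 = 0` and `Re u > -m`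
(`classA_representation`).

*Inversion.* If `‖g‖ ≥ c` on the disk of radius `R`, then for `‖w‖ < R c` the solutions of
`z * g z = w` are the fixed points of `z ↦ w / g z`, which maps the disk of radius `R` into a
strictly smaller concentric disk. By the Schwarz–Pick argument of
`deriv_ne_one_and_fixedPoint_unique` there is at most one fixed point, and it is simple. The image
of `z ↦ z * g z` is open by the open mapping theorem and relatively closed in the disk of radius
`R c` by compactness, so it contains that disk. Together these facts give a holomorphic inverse
(`exists_holomorphic_inverse_unit`, `exists_holomorphic_inverse`). With `R = c = 1` this is the
existence of the resolvent.

*Estimates.* Schwarz's lemma for `u / (u + 2 m)` yields `‖u z‖ ≤ ‖z‖ ‖u z + 2 m‖`, which confines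
`u z` to a disk. With `s = ‖z‖` this has three consequences.

* `Re (F z / z) ≥ 1 + m (1 - s) / (1 + s)`. On the disk of radius `ρ₁` the right-hand side is at
  least `(m - 1) ρ₁`, and `(m - 1) ρ₁² = ρ`, so the inversion result with `R = ρ₁` and
  `c = (m - 1) ρ₁` gives the extension to the disk of radius `ρ`.
* `‖F z / z‖ ≤ ‖β‖ + 2 m s / (1 - s)`. As `ρ₂ ≤ 1 / 3`, this bounds `‖F z‖` by `ρ` for `s < ρ₂`,
  and such a `z` is the value of the extension at `F z`.
* `‖F z‖ < 1` as soon as `2 s ‖β‖ < 1 + s²`, that is, `s < ρ₃` (`mul_norm_add_lt_one`). Here the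
  crude triangle inequality of the previous item is not enough: the disk containing `u z` has to be
  used with its exact centre.
-/

/-! ### Fixed points of holomorphic self-maps of the disk -/

lemma norm_sub_lt_norm_one_sub_conj_mul {a z : ℂ} (ha : ‖a‖ < 1) (hz : ‖z‖ < 1) :
    ‖z - a‖ < ‖1 - (starRingEnd ℂ) a * z‖ := by
  have h : ‖1 - (starRingEnd ℂ) a * z‖ ^ 2 - ‖z - a‖ ^ 2 = (1 - ‖a‖ ^ 2) * (1 - ‖z‖ ^ 2) := by
    simp only [Complex.sq_norm, Complex.normSq_apply, Complex.sub_re, Complex.sub_im,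
      Complex.mul_re, Complex.mul_im, Complex.conj_re, Complex.conj_im, Complex.one_re,
      Complex.one_im]
    ring
  have h1 : 0 < (1 - ‖a‖ ^ 2) * (1 - ‖z‖ ^ 2) := by
    apply mul_pos <;> nlinarith [norm_nonneg a, norm_nonneg z]
  exact lt_of_pow_lt_pow_left₀ 2 (norm_nonneg _) (by linarith)

lemma norm_mobius_lt_one {a z : ℂ} (ha : ‖a‖ < 1) (hz : ‖z‖ < 1) :
    ‖(z - a) / (1 - (starRingEnd ℂ) a * z)‖ < 1 := by
  have h := norm_sub_lt_norm_one_sub_conj_mul ha hz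
  rw [norm_div, div_lt_one ((norm_nonneg _).trans_lt h)]
  exact h

lemma one_sub_conj_mul_ne_zero {a z : ℂ} (ha : ‖a‖ < 1) (hz : ‖z‖ < 1) :
    1 - (starRingEnd ℂ) a * z ≠ 0 :=
  norm_pos_iff.1 ((norm_nonneg _).trans_lt (norm_sub_lt_norm_one_sub_conj_mul ha hz))

/-- A strict form of the Schwarz–Pick lemma: if a holomorphic self-map of the unit disk has
relatively compact image, then it has at most one fixed point, and that fixed point is simple. -/
theorem deriv_ne_one_and_fixedPoint_unique {φ : ℂ → ℂ} {a : ℂ} {k : ℝ} (hk : k < 1)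
    (hφ : DifferentiableOn ℂ φ (Metric.ball 0 1))
    (hmaps : Set.MapsTo φ (Metric.ball 0 1) (Metric.closedBall 0 k))
    (ha : a ∈ Metric.ball (0 : ℂ) 1) (hfix : φ a = a) :
    deriv φ a ≠ 1 ∧ ∀ b ∈ Metric.ball (0 : ℂ) 1, φ b = b → b = a := by
  have ha1 : ‖a‖ < 1 := by simpa using ha
  have hna1 : ‖-a‖ < 1 := by simpa using ha1
  set M : ℂ → ℂ := fun z => (z - a) / (1 - (starRingEnd ℂ) a * z) with hM
  set N : ℂ → ℂ := fun z => (z - -a) / (1 - (starRingEnd ℂ) (-a) * z) with hN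
  have hMd : ∀ z, ‖z‖ < 1 → DifferentiableAt ℂ M z := fun z hz =>
    DifferentiableAt.div (by fun_prop) (by fun_prop) (one_sub_conj_mul_ne_zero ha1 hz)
  have hNd : ∀ z, ‖z‖ < 1 → DifferentiableAt ℂ N z := fun z hz =>
    DifferentiableAt.div (by fun_prop) (by fun_prop) (one_sub_conj_mul_ne_zero hna1 hz)
  have hNm : ∀ z, ‖z‖ < 1 → ‖N z‖ < 1 := fun z hz => norm_mobius_lt_one hna1 hz
  have hMN : ∀ z, ‖z‖ < 1 → M (N z) = z := by
    intro z hz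
    have h1 := one_sub_conj_mul_ne_zero hna1 hz
    have h2 := one_sub_conj_mul_ne_zero ha1 (hNm z hz)
    simp only [hM, hN] at h2 ⊢
    rw [div_eq_iff h2]
    have hx := div_mul_cancel₀ (z - -a) h1
    rw [map_neg] at hx ⊢
    linear_combination hx
  have hNM : ∀ z, ‖z‖ < 1 → N (M z) = z := by
    intro z hz
    have h1 := one_sub_conj_mul_ne_zero ha1 hz
    have h2 := one_sub_conj_mul_ne_zero hna1 (norm_mobius_lt_one ha1 hz)
    simp only [hM, hN] at h2 ⊢
    rw [div_eq_iff h2]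
    have hx := div_mul_cancel₀ (z - a) h1
    rw [map_neg]
    linear_combination hx
  have hN0 : N 0 = a := by simp [hN]
  have hMa : M a = 0 := by simp [hM]
  have hk0 : 0 ≤ k := (norm_nonneg _).trans (by simpa using hmaps ha)
  -- By compactness `M` sends the smaller closed disk into a disk of radius `τ < 1`.
  obtain ⟨τ, hτ, hMτ⟩ : ∃ τ < 1, ∀ z ∈ Metric.closedBall (0 : ℂ) k, ‖M z‖ ≤ τ := by
    have hlt : ∀ z ∈ Metric.closedBall (0 : ℂ) k, ‖z‖ < 1 := fun z hz =>
      (by simpa using hz : ‖z‖ ≤ k).trans_lt hk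
    obtain ⟨z₀, hz₀, hmax⟩ := (isCompact_closedBall (0 : ℂ) k).exists_isMaxOn
      (Metric.nonempty_closedBall.2 hk0) (f := fun z => ‖M z‖)
      (fun z hz => (hMd z (hlt z hz)).continuousAt.norm.continuousWithinAt)
    exact ⟨‖M z₀‖, norm_mobius_lt_one ha1 (hlt z₀ hz₀), fun z hz => hmax hz⟩
  have hφlt : ∀ z, ‖z‖ < 1 → ‖φ z‖ < 1 := fun z hz =>
    (by simpa using hmaps (show z ∈ Metric.ball (0 : ℂ) 1 by simpa using hz) : ‖φ z‖ ≤ k).trans_lt hk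
  set f : ℂ → ℂ := fun z => M (φ (N z)) with hf
  have hφd : ∀ z, ‖z‖ < 1 → DifferentiableAt ℂ φ z := fun z hz =>
    hφ.differentiableAt (Metric.isOpen_ball.mem_nhds (by simpa using hz))
  have hfd : DifferentiableOn ℂ f (Metric.ball 0 1) := by
    intro z hz
    have hz1 : ‖z‖ < 1 := by simpa using hz
    exact ((hMd _ (hφlt _ (hNm z hz1))).comp z
      ((hφd _ (hNm z hz1)).comp z (hNd z hz1))).differentiableWithinAt
  have hf0 : f 0 = 0 := by simp [hf, hN0, hfix, hMa]
  have hfm : Set.MapsTo f (Metric.ball 0 1) (Metric.closedBall (f 0) τ) := by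
    intro z hz
    have hz1 : ‖z‖ < 1 := by simpa using hz
    rw [hf0, mem_closedBall_zero_iff]
    exact hMτ _ (hmaps (by simpa using hNm z hz1))
  constructor
  · -- The derivative of `f` at its fixed point `0` equals that of `φ` at `a`.
    intro hd
    have h1 : HasDerivAt φ 1 (N 0) := by
      rw [hN0, ← hd]; exact (hφd a ha1).hasDerivAt
    have hN' := (hNd 0 (by simp)).hasDerivAt
    have hM' : HasDerivAt M (deriv M a) (φ (N 0)) := by
      rw [hN0, hfix]; exact (hMd a ha1).hasDerivAt
    have hM'' : HasDerivAt M (deriv M a) (N 0) := by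
      rw [hN0]; exact (hMd a ha1).hasDerivAt
    have hf' : HasDerivAt f (deriv M a * (1 * deriv N 0)) 0 :=
      HasDerivAt.comp (h₂ := M) (h := fun z => φ (N z)) 0 hM' (HasDerivAt.comp 0 h1 hN')
    have hid : HasDerivAt (fun z : ℂ => M (N z)) (deriv M a * deriv N 0) 0 := hM''.comp 0 hN'
    have hid' : HasDerivAt (fun z : ℂ => M (N z)) 1 0 := by
      refine (hasDerivAt_id (0 : ℂ)).congr_of_eventuallyEq ?_
      filter_upwards [Metric.ball_mem_nhds (0 : ℂ) one_pos] with z hz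
      exact hMN z (by simpa using hz)
    have h := Complex.norm_deriv_le_div_of_mapsTo_ball hfd hfm one_pos
    rw [hf'.deriv, one_mul, hid.unique hid'] at h
    simp only [norm_one, div_one] at h
    linarith
  · intro b hb hfb
    have hb1 : ‖b‖ < 1 := by simpa using hb
    have hMb : M b ∈ Metric.ball (0 : ℂ) 1 := by
      exact mem_ball_zero_iff.2 (norm_mobius_lt_one ha1 hb1)
    have h := Complex.dist_le_div_mul_dist_of_mapsTo_ball hfd hfm hMb
    have hfM : f (M b) = M b := by simp only [hf, hNM b hb1, hfb]
    rw [hfM, hf0, dist_zero_right, div_one] at h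
    have h0 : ‖M b‖ = 0 := by nlinarith [norm_nonneg (M b)]
    rw [← hNM b hb1, norm_eq_zero.1 h0, hN0]

/-! ### Holomorphic inverses of `z ↦ z * g z` -/

/-- For `‖w‖ < 1` the solutions of `z * g z = w` are the fixed points of `z ↦ w / g z`, a
self-map of the unit disk with relatively compact image; this gives uniqueness and, through the
derivative at the fixed point, holomorphy. Solutions exist because the image of `z ↦ z * g z` is
relatively open and closed in the unit disk. -/
theorem exists_holomorphic_inverse_unit {g : ℂ → ℂ}
    (hg : DifferentiableOn ℂ g (Metric.ball 0 1))
    (hg1 : ∀ z ∈ Metric.ball (0 : ℂ) 1, 1 ≤ ‖g z‖) :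
    ∃ G : ℂ → ℂ, DifferentiableOn ℂ G (Metric.ball 0 1) ∧
      Set.MapsTo G (Metric.ball 0 1) (Metric.ball 0 1) ∧
      ∀ w ∈ Metric.ball (0 : ℂ) 1, ∀ z ∈ Metric.ball (0 : ℂ) 1, z * g z = w ↔ z = G w := by
  set D : Set ℂ := Metric.ball 0 1 with hD
  set F : ℂ → ℂ := fun z => z * g z with hF
  have hgne : ∀ z ∈ D, g z ≠ 0 := fun z hz =>
    norm_pos_iff.1 (one_pos.trans_le (hg1 z hz))
  have hFd : DifferentiableOn ℂ F D := differentiableOn_id.mul hg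
  have hFle : ∀ z ∈ D, ‖z‖ ≤ ‖F z‖ := fun z hz => by
    rw [show F z = z * g z from rfl, norm_mul]
    exact le_mul_of_one_le_right (norm_nonneg _) (hg1 z hz)
  have hfixed : ∀ w ∈ D, ∀ z ∈ D, F z = w →
      deriv (fun x => w / g x) z ≠ 1 ∧ ∀ z' ∈ D, F z' = w → z' = z := by
    intro w hw z hz hzw
    have key := deriv_ne_one_and_fixedPoint_unique (φ := fun x => w / g x) (a := z) (k := ‖w‖)
      (by simpa [hD] using hw) ((differentiableOn_const w).div hg hgne)
      (fun x hx => by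
        rw [mem_closedBall_zero_iff, norm_div]
        exact div_le_self (norm_nonneg _) (hg1 x hx))
      hz (by rw [← hzw]; exact mul_div_cancel_right₀ z (hgne z hz))
    exact ⟨key.1, fun z' hz' h => key.2 z' hz' (by
      rw [← h]; exact mul_div_cancel_right₀ z' (hgne z' hz'))⟩
  have hopen : ∀ s ⊆ D, IsOpen s → IsOpen (F '' s) := by
    refine ((hFd.analyticOnNhd Metric.isOpen_ball).is_constant_or_isOpen
      (convex_ball (0 : ℂ) 1).isPreconnected).resolve_left ?_
    rintro ⟨c, hc⟩
    have h0 : F 0 = c := hc 0 (Metric.mem_ball_self one_pos)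
    have hh : (1 / 2 : ℂ) ∈ D := by simp [hD]; norm_num
    have h1 := hc _ hh
    have h2 := hFle _ hh
    rw [h1, ← h0] at h2
    norm_num [hF] at h2
  have hsurj : D ⊆ F '' D := by
    refine (convex_ball (0 : ℂ) 1).isPreconnected.subset_of_closure_inter_subset
      (hopen D subset_rfl Metric.isOpen_ball) ⟨0, by simp, 0, by simp [hD], by simp [hF]⟩ ?_
    rintro w ⟨hwc, hw⟩
    have hw1 : ‖w‖ < 1 := by simpa using hw
    obtain ⟨s, hws, hs1⟩ := exists_between hw1
    have hsub : Metric.closedBall (0 : ℂ) s ⊆ D := Metric.closedBall_subset_ball hs1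
    have hcl : IsClosed (F '' Metric.closedBall 0 s) :=
      ((isCompact_closedBall (0 : ℂ) s).image_of_continuousOn
        (hFd.continuousOn.mono hsub)).isClosed
    have hmem : w ∈ closure (Metric.ball 0 s ∩ F '' D) :=
      Metric.isOpen_ball.inter_closure ⟨by simpa using hws, hwc⟩
    -- Points of `D` with image in the disk of radius `s` lie in that disk, as `‖z‖ ≤ ‖F z‖`.
    have hincl : Metric.ball 0 s ∩ F '' D ⊆ F '' Metric.closedBall 0 s := by
      rintro _ ⟨hx, z, hz, rfl⟩
      refine ⟨z, ?_, rfl⟩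
      rw [mem_closedBall_zero_iff]
      exact (hFle z hz).trans (mem_ball_zero_iff.1 hx).le
    exact Set.image_mono hsub (hcl.closure_subset_iff.2 hincl hmem)
  have hex : ∀ w, ∃ z, w ∈ D → z ∈ D ∧ F z = w := fun w => by
    by_cases hw : w ∈ D
    · obtain ⟨z, hz, hzw⟩ := hsurj hw
      exact ⟨z, fun _ => ⟨hz, hzw⟩⟩
    · exact ⟨0, fun h => absurd h hw⟩
  choose G hG using hex
  refine ⟨G, ?_, fun w hw => (hG w hw).1, fun w hw z hz =>
    ⟨fun h => (hfixed w hw _ (hG w hw).1 (hG w hw).2).2 z hz h, fun h => h ▸ (hG w hw).2⟩⟩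
  intro w hw
  obtain ⟨hz, hzw⟩ := hG w hw
  have hcont : ContinuousAt G w := by
    intro U hU
    obtain ⟨O, hOU, hO, hzO⟩ := mem_nhds_iff.1 (Filter.inter_mem hU (Metric.isOpen_ball.mem_nhds hz))
    have hnhds : F '' O ∈ nhds w :=
      (hopen O (fun x hx => (hOU hx).2) hO).mem_nhds ⟨G w, hzO, hzw⟩
    rw [Filter.mem_map]
    filter_upwards [hnhds, Metric.isOpen_ball.mem_nhds hw] with w' hw' hw'D
    obtain ⟨z', hz', hzw'⟩ := hw'
    have := (hfixed w' hw'D _ (hG w' hw'D).1 (hG w' hw'D).2).2 z' (hOU hz').2 hzw'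
    rw [Set.mem_preimage, ← this]
    exact (hOU hz').1
  have hgd : HasDerivAt g (deriv g (G w)) (G w) :=
    (hg.differentiableAt (Metric.isOpen_ball.mem_nhds hz)).hasDerivAt
  have hF' : HasDerivAt F (1 * g (G w) + G w * deriv g (G w)) (G w) :=
    (hasDerivAt_id (G w)).mul hgd
  have hne : 1 * g (G w) + G w * deriv g (G w) ≠ 0 := by
    intro h0
    apply (hfixed w hw _ hz hzw).1
    have hne := hgne _ hz
    have hd : HasDerivAt (fun x => w / g x)
        ((0 * g (G w) - w * deriv g (G w)) / g (G w) ^ 2) (G w) :=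
      (hasDerivAt_const (G w) w).div hgd hne
    rw [hd.deriv, div_eq_one_iff_eq (pow_ne_zero 2 hne)]
    have : w = G w * g (G w) := hzw.symm
    calc 0 * g (G w) - w * deriv g (G w) = 0 * g (G w) - G w * g (G w) * deriv g (G w) := by
          rw [← this]
      _ = g (G w) ^ 2 := by linear_combination (-g (G w)) * h0
  refine (HasDerivAt.of_local_left_inverse hcont hF' hne
    ?_).differentiableAt.differentiableWithinAt
  filter_upwards [Metric.isOpen_ball.mem_nhds hw] with w' hw'
  exact (hG w' hw').2

/-- Rescaled form: the lower bound `c` for `‖g‖` on the disk of radius `R` gives an inverse of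
`z ↦ z * g z` on the disk of radius `R * c`. -/
theorem exists_holomorphic_inverse {g : ℂ → ℂ} {R c : ℝ} (hR : 0 < R) (hc : 0 < c)
    (hg : DifferentiableOn ℂ g (Metric.ball 0 R))
    (hgc : ∀ z ∈ Metric.ball (0 : ℂ) R, c ≤ ‖g z‖) :
    ∃ G : ℂ → ℂ, DifferentiableOn ℂ G (Metric.ball 0 (R * c)) ∧
      Set.MapsTo G (Metric.ball 0 (R * c)) (Metric.ball 0 R) ∧
      ∀ w ∈ Metric.ball (0 : ℂ) (R * c), ∀ z ∈ Metric.ball (0 : ℂ) R,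
        z * g z = w ↔ z = G w := by
  have hRc : 0 < R * c := mul_pos hR hc
  have hRC : (R : ℂ) ≠ 0 := by exact_mod_cast hR.ne'
  have hcC : (c : ℂ) ≠ 0 := by exact_mod_cast hc.ne'
  have hmulR : ∀ z ∈ Metric.ball (0 : ℂ) 1, R * z ∈ Metric.ball (0 : ℂ) R := fun z hz => by
    rw [mem_ball_zero_iff] at hz ⊢
    rw [norm_mul, Complex.norm_real, Real.norm_of_nonneg hR.le]
    nlinarith
  have hdiv : ∀ {t : ℝ}, 0 < t → ∀ z ∈ Metric.ball (0 : ℂ) t,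
      z / t ∈ Metric.ball (0 : ℂ) 1 := fun {t} ht z hz => by
    rw [mem_ball_zero_iff] at hz ⊢
    rwa [norm_div, Complex.norm_real, Real.norm_of_nonneg ht.le, div_lt_one ht]
  obtain ⟨G, hGd, hGm, hGi⟩ := exists_holomorphic_inverse_unit (g := fun z => g (R * z) / c)
    (DifferentiableOn.div_const (hg.comp (by fun_prop) hmulR) _)
    (fun z hz => by
      rw [norm_div, Complex.norm_real, Real.norm_of_nonneg hc.le, one_le_div hc]
      exact hgc _ (hmulR z hz))
  refine ⟨fun w => R * G (w / (R * c : ℝ)), ?_, ?_, ?_⟩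
  · exact (hGd.comp (by fun_prop) (hdiv hRc)).const_mul _
  · exact fun w hw => hmulR _ (hGm (hdiv hRc w hw))
  · intro w hw z hz
    have h := hGi _ (hdiv hRc w hw) _ (hdiv hR z hz)
    rw [mul_div_cancel₀ z hRC] at h
    calc z * g z = w ↔ z / R * (g z / c) = w / (R * c : ℝ) := by
          push_cast
          rw [div_mul_div_comm, div_left_inj' (mul_ne_zero hRC hcC)]
      _ ↔ z / R = G (w / (R * c : ℝ)) := h
      _ ↔ z = R * G (w / (R * c : ℝ)) := by rw [div_eq_iff hRC, mul_comm]

/-! ### Estimates for functions with real part bounded below -/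

/-- Schwarz's lemma for the Cayley transform `u / (u + 2 m)`. -/
theorem norm_le_norm_mul_norm_add_of_neg_lt_re {u : ℂ → ℂ} {m : ℝ} (hm : 0 < m)
    (hu : DifferentiableOn ℂ u (Metric.ball 0 1)) (hu0 : u 0 = 0)
    (hre : ∀ z ∈ Metric.ball (0 : ℂ) 1, -m < (u z).re) {z : ℂ} (hz : ‖z‖ < 1) :
    ‖u z‖ ≤ ‖z‖ * ‖u z + 2 * m‖ := by
  have hne : ∀ z ∈ Metric.ball (0 : ℂ) 1, u z + 2 * m ≠ 0 := by
    intro z hz h0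
    have h1 := congrArg Complex.re h0
    have h2 := hre z hz
    simp at h1
    linarith
  have hle : ∀ z ∈ Metric.ball (0 : ℂ) 1, ‖u z‖ ≤ ‖u z + 2 * m‖ := by
    intro z hz
    have h2 := hre z hz
    refine le_of_sq_le_sq ?_ (norm_nonneg _)
    simp only [Complex.sq_norm, Complex.normSq_apply, Complex.add_re, Complex.add_im,
      Complex.mul_re, Complex.mul_im, Complex.ofReal_re, Complex.ofReal_im, Complex.re_ofNat,
      Complex.im_ofNat]
    nlinarith
  have h := Complex.norm_le_norm_of_mapsTo_ball (f := fun z => u z / (u z + 2 * m)) (z := z)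
    (hu.div (hu.add_const _) hne)
    (fun z hz => by
      rw [mem_closedBall_zero_iff, norm_div]
      exact div_le_one_of_le₀ (hle z hz) (norm_nonneg _)) (by simp [hu0]) hz
  rwa [norm_div, div_le_iff₀ (norm_pos_iff.2 (hne z (by simpa using hz)))] at h

/-- The inequality `‖u‖ ≤ s ‖u + 2 m‖` describes a disk; this is its expanded form. -/
lemma one_sub_sq_mul_norm_sq_le {u : ℂ} {m s : ℝ}
    (h : ‖u‖ ≤ s * ‖u + 2 * m‖) :
    (1 - s ^ 2) * ‖u‖ ^ 2 ≤ 4 * m * s ^ 2 * u.re + 4 * m ^ 2 * s ^ 2 := by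
  have h1 : ‖u‖ ^ 2 ≤ (s * ‖u + 2 * m‖) ^ 2 := pow_le_pow_left₀ (norm_nonneg _) h 2
  have h2 : ‖u + 2 * m‖ ^ 2 = ‖u‖ ^ 2 + 4 * m * u.re + 4 * m ^ 2 := by
    simp only [Complex.sq_norm, Complex.normSq_apply, Complex.add_re, Complex.add_im,
      Complex.mul_re, Complex.mul_im, Complex.ofReal_re, Complex.ofReal_im, Complex.re_ofNat,
      Complex.im_ofNat]
    ring
  rw [mul_pow, h2] at h1
  linarith

lemma neg_div_le_re {u : ℂ} {m s : ℝ} (hm : 0 < m) (hs : 0 ≤ s) (hs1 : s < 1)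
    (h : ‖u‖ ≤ s * ‖u + 2 * m‖) : -(2 * m * s / (1 + s)) ≤ u.re := by
  have h1 := one_sub_sq_mul_norm_sq_le h
  have h2 : u.re ^ 2 ≤ ‖u‖ ^ 2 := by
    rw [← sq_abs]; exact pow_le_pow_left₀ (abs_nonneg _) (Complex.abs_re_le_norm u) 2
  have h3 : (1 - s ^ 2) * u.re ^ 2 ≤ (1 - s ^ 2) * ‖u‖ ^ 2 :=
    mul_le_mul_of_nonneg_left h2 (by nlinarith)
  rw [neg_le, le_div_iff₀ (by linarith)]
  by_contra! hc
  have h4 : 0 < -(u.re * (1 + s)) - 2 * m * s := by linarith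
  have hms : 0 ≤ m * s := by positivity
  have hx : u.re < 0 := by nlinarith
  have h5 : 0 < 2 * m * s - (1 - s) * u.re := by nlinarith
  nlinarith [mul_pos h4 h5]

lemma norm_le_div_one_sub {u : ℂ} {m s : ℝ} (hm : 0 < m) (hs : 0 ≤ s) (hs1 : s < 1)
    (h : ‖u‖ ≤ s * ‖u + 2 * m‖) : ‖u‖ ≤ 2 * m * s / (1 - s) := by
  have h1 : ‖u + 2 * m‖ ≤ ‖u‖ + 2 * m := by
    refine (norm_add_le _ _).trans_eq ?_
    rw [norm_mul, Complex.norm_real, Real.norm_of_nonneg hm.le, Complex.norm_ofNat]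
  rw [le_div_iff₀ (by linarith)]
  nlinarith [mul_le_mul_of_nonneg_left h1 hs]

/-- The disk form of `‖u‖ ≤ s ‖u + 2 m‖`. -/
lemma norm_sub_center_le {u : ℂ} {m s : ℝ} (hm : 0 < m) (hs : 0 ≤ s) (hs1 : s < 1)
    (h : ‖u‖ ≤ s * ‖u + 2 * m‖) :
    ‖u - (2 * m * s ^ 2 / (1 - s ^ 2) : ℝ)‖ ≤ 2 * m * s / (1 - s ^ 2) := by
  have h1 := one_sub_sq_mul_norm_sq_le h
  have hd : 0 < 1 - s ^ 2 := by nlinarith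
  refine le_of_sq_le_sq ?_ (by positivity)
  set c := 2 * m * s ^ 2 / (1 - s ^ 2) with hc
  have h2 : ‖u - (c : ℝ)‖ ^ 2 = ‖u‖ ^ 2 - 2 * c * u.re + c ^ 2 := by
    simp only [Complex.sq_norm, Complex.normSq_apply, Complex.sub_re, Complex.sub_im,
      Complex.ofReal_re, Complex.ofReal_im]
    ring
  rw [h2]
  have h3 : ‖u‖ ^ 2 ≤ (4 * m * s ^ 2 * u.re + 4 * m ^ 2 * s ^ 2) / (1 - s ^ 2) := by
    rw [le_div_iff₀ hd]; linarith
  have h4 : (4 * m * s ^ 2 * u.re + 4 * m ^ 2 * s ^ 2) / (1 - s ^ 2) - 2 * c * u.re + c ^ 2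
      = (2 * m * s / (1 - s ^ 2)) ^ 2 := by
    rw [hc]; field_simp; ring
  linarith

/-- If `s` is smaller than the root `B - √(B² - 1)` of `s² - 2 B s + 1`, where `B = ‖β‖`, then
the disk of possible values of `β + u` lies in the disk of radius `1 / s`. -/
lemma mul_norm_add_lt_one {β u : ℂ} {m s : ℝ} (hm : 0 < m) (hs : 0 < s) (hs1 : s < 1)
    (hβ : β.re = 1 + m) (hB : 2 * s * ‖β‖ < 1 + s ^ 2)
    (h : ‖u‖ ≤ s * ‖u + 2 * m‖) : s * ‖β + u‖ < 1 := by
  have hd : 0 < 1 - s ^ 2 := by nlinarith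
  have hdisk := norm_sub_center_le hm hs.le hs1 h
  set c := 2 * m * s ^ 2 / (1 - s ^ 2) with hc
  set ρ := 2 * m * s / (1 - s ^ 2) with hρ
  have hmB : 1 + m ≤ ‖β‖ := hβ ▸ Complex.re_le_norm β
  have hm2 : 2 * s * m ≤ (1 - s) ^ 2 := by nlinarith
  have hcβ : ‖β + (c : ℝ)‖ ^ 2 = ‖β‖ ^ 2 + 2 * c * (1 + m) + c ^ 2 := by
    rw [← hβ]
    simp only [Complex.sq_norm, Complex.normSq_apply, Complex.add_re, Complex.add_im,
      Complex.ofReal_re, Complex.ofReal_im]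
    ring
  have hB2 : 4 * s ^ 2 * ‖β‖ ^ 2 < (1 + s ^ 2) ^ 2 := by
    have := pow_lt_pow_left₀ hB (by positivity) two_ne_zero
    linarith
  have hρs : ρ ≤ 1 / s := by
    rw [hρ, div_le_div_iff₀ hd hs]
    nlinarith
  have hpoly : 16 * m * s ^ 2 * (1 + s ^ 2) ≤ (1 - s ^ 2) ^ 2 * (3 + s ^ 2) := by
    have e1 : 16 * m * s ^ 2 * (1 + s ^ 2) ≤ 8 * s * (1 + s ^ 2) * (1 - s) ^ 2 := by
      have : 0 ≤ 8 * s * (1 + s ^ 2) := by positivity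
      nlinarith [mul_le_mul_of_nonneg_left hm2 this]
    have e2 : (1 - s ^ 2) ^ 2 * (3 + s ^ 2) - 8 * s * (1 + s ^ 2) * (1 - s) ^ 2
        = (1 - s) ^ 2 * ((1 - s) * (3 + s + 5 * s ^ 2 - s ^ 3)) := by ring
    have e3 : 0 ≤ 3 + s + 5 * s ^ 2 - s ^ 3 := by nlinarith [pow_pos hs 2]
    have e4 : 0 ≤ (1 - s) ^ 2 * ((1 - s) * (3 + s + 5 * s ^ 2 - s ^ 3)) :=
      mul_nonneg (sq_nonneg _) (mul_nonneg (by linarith) e3)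
    linarith
  have hlt : ‖β + (c : ℝ)‖ < 1 / s - ρ := by
    refine lt_of_pow_lt_pow_left₀ 2 (by linarith) ?_
    have hdiff : (1 / s - ρ) ^ 2 - ‖β + (c : ℝ)‖ ^ 2
        = (((1 + s ^ 2) ^ 2 - 4 * s ^ 2 * ‖β‖ ^ 2) * (1 - s ^ 2)
          + ((1 - s ^ 2) ^ 2 * (3 + s ^ 2) - 16 * m * s ^ 2 * (1 + s ^ 2)))
          / (4 * s ^ 2 * (1 - s ^ 2)) := by
      rw [hcβ, hc, hρ]; field_simp; ring
    have : 0 < (1 / s - ρ) ^ 2 - ‖β + (c : ℝ)‖ ^ 2 := by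
      rw [hdiff]
      refine div_pos (add_pos_of_pos_of_nonneg (mul_pos (by linarith) hd) (by linarith))
        (by positivity)
    linarith
  have : ‖β + u‖ < 1 / s := by
    calc ‖β + u‖ = ‖(β + (c : ℝ)) + (u - (c : ℝ))‖ := by congr 1; ring
      _ ≤ ‖β + (c : ℝ)‖ + ‖u - (c : ℝ)‖ := norm_add_le _ _
      _ < 1 / s := by linarith
  rwa [lt_div_iff₀ hs, mul_comm] at this

/-! ### The constants -/

/-- The disk of radius `ρ₁` and the lower bound `(r Re q - 1) ρ₁` for `‖F z / z‖` on it together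
give the radius `ρ` of the disk on which the inverse is defined. -/
lemma rho_eq_mul_rhoOne_sq {q : ℂ} {r : ℝ} (h : 1 < r * q.re) :
    rho q r = (r * q.re - 1) * rhoOne q r ^ 2 := by
  have h1 : 0 < r * q.re - 1 := by linarith
  have h2 : 2 * r * q.re = 2 * r * q.re / (r * q.re - 1) * (r * q.re - 1) :=
    (div_mul_cancel₀ _ h1.ne').symm
  have h3 : 0 ≤ 2 * r * q.re / (r * q.re - 1) := div_nonneg (by linarith) h1.le
  have h4 : √(2 * r * q.re) = √(2 * r * q.re / (r * q.re - 1)) * √(r * q.re - 1) := by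
    rw [← Real.sqrt_mul h3, ← h2]
  rw [rho, rhoOne, h4]
  linear_combination (√(2 * r * q.re / (r * q.re - 1)) - 1) ^ 2 * Real.sq_sqrt h1.le

lemma rhoOne_add_one_sq {q : ℂ} {r : ℝ} (h : 1 < r * q.re) :
    (r * q.re - 1) * (rhoOne q r + 1) ^ 2 = 2 * (r * q.re) := by
  have h1 : 0 < r * q.re - 1 := by linarith
  have h3 : 0 ≤ 2 * r * q.re / (r * q.re - 1) := div_nonneg (by linarith) h1.le
  rw [rhoOne, sub_add_cancel, Real.sq_sqrt h3, mul_div_cancel₀ _ h1.ne']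
  ring

lemma rhoOne_pos {q : ℂ} {r : ℝ} (h : 1 < r * q.re) : 0 < rhoOne q r := by
  have h1 : 0 < r * q.re - 1 := by linarith
  rw [rhoOne, sub_pos]
  refine Real.lt_sqrt_of_sq_lt ?_
  rw [one_pow, one_lt_div h1]
  linarith

lemma rhoOne_lt_one {q : ℂ} {r : ℝ} (h : 2 < r * q.re) : rhoOne q r < 1 := by
  have h1 := rhoOne_add_one_sq (q := q) (r := r) (by linarith)
  have h2 := rhoOne_pos (q := q) (r := r) (by linarith)
  by_contra! hc
  have h3 : 4 ≤ (rhoOne q r + 1) ^ 2 := by nlinarith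
  nlinarith

lemma one_lt_rho {q : ℂ} {r : ℝ} (h : 2 < r * q.re) : 1 < rho q r := by
  have h1 := rhoOne_add_one_sq (q := q) (r := r) (by linarith)
  have h2 := rhoOne_lt_one h
  rw [rho_eq_mul_rhoOne_sq (by linarith)]
  have h3 : 0 < (r * q.re - 1) * (1 - rhoOne q r) ^ 2 :=
    mul_pos (by linarith) (pow_pos (by linarith) 2)
  nlinarith

lemma rho_le {q : ℂ} {r : ℝ} (h : 2 < r * q.re) : rho q r ≤ 2 / 3 * (r * q.re) := by
  have h1 := rhoOne_add_one_sq (q := q) (r := r) (by linarith)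
  have h2 := rhoOne_lt_one h
  have h0 := rhoOne_pos (q := q) (r := r) (by linarith)
  rw [rho_eq_mul_rhoOne_sq (by linarith)]
  have h3 : 0 ≤ (r * q.re - 1) * (1 + 2 * rhoOne q r - 2 * rhoOne q r ^ 2) :=
    mul_nonneg (by linarith) (by nlinarith)
  nlinarith

lemma rhoTwo_eq (q : ℂ) (r : ℝ) : rhoTwo q r =
    rho q r / (‖1 + (r : ℂ) * q‖ + √(2 + r * q.re + r ^ 2 * ‖q‖ ^ 2)) := rfl

lemma re_one_add_ofReal_mul (q : ℂ) (r : ℝ) : (1 + (r : ℂ) * q).re = 1 + r * q.re := by simp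

lemma mul_re_le_sqrt {q : ℂ} {r : ℝ} (hr : 0 < r) (hq : 0 < q.re) :
    r * q.re ≤ √(2 + r * q.re + r ^ 2 * ‖q‖ ^ 2) := by
  refine Real.le_sqrt_of_sq_le ?_
  have h1 : q.re ^ 2 ≤ ‖q‖ ^ 2 := pow_le_pow_left₀ hq.le (Complex.re_le_norm q) 2
  have h2 : r ^ 2 * q.re ^ 2 ≤ r ^ 2 * ‖q‖ ^ 2 := mul_le_mul_of_nonneg_left h1 (sq_nonneg r)
  nlinarith [mul_pos hr hq]

/-! ### The class of functions `z * (β + u z)` -/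

/-- Functions of the class are `z (β + u z)` with `u` holomorphic, `u 0 = 0` and `Re u > -m`; here
`β + u` is the quotient `F z / z` with its removable value at `0`. -/
theorem classA_representation {F : ℂ → ℂ} {m : ℝ} {β : ℂ} (hm : 0 < m)
    (hF : F ∈ classA ((2 * m : ℝ) : ℂ) β) :
    ∃ u : ℂ → ℂ, DifferentiableOn ℂ u (Metric.ball 0 1) ∧ u 0 = 0 ∧
      (∀ z ∈ Metric.ball (0 : ℂ) 1, -m < (u z).re) ∧ ∀ z, F z = z * (β + u z) := by
  obtain ⟨hd, h0, hβ, hre⟩ := hF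
  refine ⟨fun z => dslope F 0 z - β, ?_, ?_, ?_, ?_⟩
  · exact ((Complex.differentiableOn_dslope (Metric.ball_mem_nhds 0 one_pos)).2 hd).sub_const β
  · simp [hβ]
  · intro z hz
    rcases eq_or_ne z 0 with rfl | hz0
    · simpa [hβ] using hm
    · have h := hre z hz hz0
      rw [one_div ((2 * m : ℝ) : ℂ), ← Complex.ofReal_inv, Complex.re_ofReal_mul, inv_mul_eq_div,
        lt_div_iff₀ (by linarith)] at h
      simp only [dslope_of_ne F hz0, slope_def_field, h0, sub_zero]
      linarith
  · intro z
    have h := sub_smul_dslope F 0 z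
    rw [h0, sub_zero, sub_zero, smul_eq_mul] at h
    rw [add_sub_cancel, h]

theorem mainTheorem2 (q : ℂ) (hq : 0 < q.re) (r : ℝ) (hr : 0 < r) :
    -- every `F` in the class has a well-defined holomorphic inverse on the unit disk
    (∀ F ∈ classA ((2 * r * q.re : ℝ) : ℂ) (1 + r * q), ∃ G : ℂ → ℂ,
      DifferentiableOn ℂ G (Metric.ball 0 1) ∧
      Set.MapsTo G (Metric.ball 0 1) (Metric.ball 0 1) ∧
      ∀ w ∈ Metric.ball (0 : ℂ) 1, ∀ z ∈ Metric.ball (0 : ℂ) 1, F z = w ↔ z = G w) ∧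
    ∀ G ∈ classJ q r,
      -- (a) and (b)
      (2 / q.re < r →
        1 < rho q r ∧
        ∃ Gext : ℂ → ℂ,
          Set.EqOn Gext G (Metric.ball 0 1) ∧
          DifferentiableOn ℂ Gext (Metric.ball 0 (rho q r)) ∧
          Set.InjOn Gext (Metric.ball 0 (rho q r)) ∧
          Gext '' Metric.ball 0 (rho q r) ⊆ Metric.ball 0 (rhoOne q r) ∧
          Metric.ball 0 (rhoTwo q r) ⊆ Gext '' Metric.ball 0 (rho q r)) ∧
      -- (c)
      Metric.ball 0 (rhoThree q r) ⊆ G '' Metric.ball 0 1 := by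
  have hm : 0 < r * q.re := mul_pos hr hq
  have hβ := re_one_add_ofReal_mul q r
  have hB : 1 + r * q.re ≤ ‖1 + (r : ℂ) * q‖ := hβ ▸ Complex.re_le_norm _
  have hexists : ∀ F ∈ classA ((2 * r * q.re : ℝ) : ℂ) (1 + r * q), ∃ G : ℂ → ℂ,
      DifferentiableOn ℂ G (Metric.ball 0 1) ∧
      Set.MapsTo G (Metric.ball 0 1) (Metric.ball 0 1) ∧
      ∀ w ∈ Metric.ball (0 : ℂ) 1, ∀ z ∈ Metric.ball (0 : ℂ) 1, F z = w ↔ z = G w := by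
    intro F hF
    rw [mul_assoc 2 r] at hF
    obtain ⟨u, hud, -, hre, hFu⟩ := classA_representation hm hF
    simp only [hFu]
    refine exists_holomorphic_inverse_unit (hud.const_add _) fun z hz => ?_
    refine le_trans ?_ (Complex.re_le_norm _)
    have := hre z hz
    rw [Complex.add_re, hβ]
    linarith
  refine ⟨hexists, ?_⟩
  rintro G ⟨F, hF, hG⟩
  obtain ⟨G₁, -, -, hG₁⟩ := hexists F hF
  have hinj : ∀ z ∈ Metric.ball (0 : ℂ) 1, F z ∈ Metric.ball (0 : ℂ) 1 → z = G (F z) := by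
    intro z hz hw
    exact ((hG₁ _ hw z hz).1 rfl).trans ((hG₁ _ hw _ (hG _ hw).1).1 (hG _ hw).2).symm
  rw [mul_assoc 2 r] at hF
  obtain ⟨u, hud, hu0, hre, hFu⟩ := classA_representation hm hF
  have hS : ∀ z : ℂ, ‖z‖ < 1 → ‖u z‖ ≤ ‖z‖ * ‖u z + 2 * (r * q.re : ℝ)‖ := fun z hz =>
    norm_le_norm_mul_norm_add_of_neg_lt_re hm hud hu0 hre hz
  have hFn : ∀ z, ‖F z‖ = ‖z‖ * ‖1 + (r : ℂ) * q + u z‖ := fun z => by rw [hFu, norm_mul]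
  constructor
  · intro hrq
    have hm2 : 2 < r * q.re := (div_lt_iff₀ hq).1 hrq
    have hm1 : 1 < r * q.re := by linarith
    have hρ := one_lt_rho hm2
    have h10 := rhoOne_pos hm1
    have h11 := rhoOne_lt_one hm2
    have hρ1 := rho_eq_mul_rhoOne_sq hm1
    have hsub : Metric.ball (0 : ℂ) (rhoOne q r) ⊆ Metric.ball 0 1 :=
      Metric.ball_subset_ball h11.le
    have hprod : rhoOne q r * ((r * q.re - 1) * rhoOne q r) = rho q r := by rw [hρ1]; ring
    obtain ⟨E, hEd, hEm, hE⟩ := exists_holomorphic_inverse (g := fun z => 1 + (r : ℂ) * q + u z)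
      (R := rhoOne q r) (c := (r * q.re - 1) * rhoOne q r) h10
      (mul_pos (by linarith) h10) ((hud.const_add _).mono hsub) (fun z hz => by
        have hz1 : ‖z‖ < 1 := mem_ball_zero_iff.1 (hsub hz)
        have hzs : ‖z‖ < rhoOne q r := mem_ball_zero_iff.1 hz
        refine le_trans ?_ (Complex.re_le_norm _)
        rw [Complex.add_re, hβ]
        -- The lower bound `1 + m (1 - s) / (1 + s)`, `m = r Re q`, decreases in `s` and has
        -- the value `(m - 1) ρ₁` at `s = ρ₁`.
        have h1 := neg_div_le_re hm (norm_nonneg z) hz1 (hS z hz1)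
        have h2 : 2 * (r * q.re) * ‖z‖ / (1 + ‖z‖)
            ≤ 2 * (r * q.re) - (r * q.re - 1) * (rhoOne q r + 1) := by
          rw [div_le_iff₀ (by linarith [norm_nonneg z])]
          have h3 := rhoOne_add_one_sq hm1
          have h4 : 0 ≤ (r * q.re - 1) * (rhoOne q r + 1) * (rhoOne q r - ‖z‖) :=
            mul_nonneg (mul_nonneg (by linarith) (by linarith)) (by linarith)
          nlinarith
        linarith)
    rw [hprod] at hEd hEm hE
    have hright : ∀ w ∈ Metric.ball (0 : ℂ) (rho q r), F (E w) = w := fun w hw => by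
      rw [hFu]; exact (hE w hw _ (hEm hw)).2 rfl
    refine ⟨hρ, E, ?_, hEd, ?_, Set.image_subset_iff.2 hEm, ?_⟩
    · intro w hw
      have hw' := Metric.ball_subset_ball hρ.le hw
      have h := hinj (E w) (hsub (hEm hw')) (by rwa [hright w hw'])
      rwa [hright w hw'] at h
    · intro w hw w' hw' h
      rw [← hright w hw, ← hright w' hw', h]
    · intro z hz
      rw [mem_ball_zero_iff, rhoTwo_eq] at hz
      have hT := mul_re_le_sqrt hr hq
      set S := √(2 + r * q.re + r ^ 2 * ‖q‖ ^ 2)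
      have hρm := rho_le hm2
      have hBS : 0 < ‖1 + (r : ℂ) * q‖ + S := by linarith
      have hzρ : ‖z‖ * (‖1 + (r : ℂ) * q‖ + S) < rho q r := (lt_div_iff₀ hBS).1 hz
      have hz3 : ‖z‖ ≤ 1 / 3 := by
        refine hz.le.trans ((div_le_iff₀ hBS).2 ?_)
        linarith
      have hz1 : ‖z‖ < 1 := by linarith
      -- Here `‖F z / z‖ ≤ B + 2 m s / (1 - s) ≤ B + m ≤ B + S` for `B = ‖1 + r q‖`, `m = r Re q`
      -- and `s = ‖z‖ ≤ 1 / 3`.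
      have hFz : F z ∈ Metric.ball (0 : ℂ) (rho q r) := by
        rw [mem_ball_zero_iff, hFn]
        refine lt_of_le_of_lt (mul_le_mul_of_nonneg_left ?_ (norm_nonneg z)) hzρ
        refine (norm_add_le _ _).trans (add_le_add_right ?_ _)
        refine (norm_le_div_one_sub hm (norm_nonneg z) hz1 (hS z hz1)).trans ?_
        rw [div_le_iff₀ (by linarith)]
        nlinarith
      refine ⟨F z, hFz, ?_⟩
      refine ((hE _ hFz z ?_).1 (hFu z).symm).symm
      rw [mem_ball_zero_iff]
      -- `ρ = (r Re q - 1) ρ₁²` with `ρ₁ < 1`, and the denominator of `ρ₂` exceeds `r Re q - 1`.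
      refine hz.trans ((div_lt_iff₀ hBS).2 ?_)
      rw [← hprod]
      refine mul_lt_mul_of_pos_left ?_ h10
      nlinarith
  · intro z hz
    rw [mem_ball_zero_iff, rhoThree] at hz
    set B := ‖1 + (r : ℂ) * q‖
    have hB1 : 1 < B := by linarith
    have hT2 : √(B ^ 2 - 1) ^ 2 = B ^ 2 - 1 := Real.sq_sqrt (by nlinarith)
    have hT0 := Real.sqrt_nonneg (B ^ 2 - 1)
    set T := √(B ^ 2 - 1)
    have hzB : ‖z‖ * (B + T) < 1 := (lt_div_iff₀ (by linarith)).1 hz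
    have hz1 : ‖z‖ < 1 := by
      refine hz.trans_le ?_
      rw [div_le_one (by linarith)]
      linarith
    have hFz : F z ∈ Metric.ball (0 : ℂ) 1 := by
      rw [mem_ball_zero_iff, hFn]
      rcases eq_or_ne z 0 with rfl | hz0
      · simp
      · refine mul_norm_add_lt_one hm (norm_pos_iff.2 hz0) hz1 hβ ?_ (hS z hz1)
        -- Square `‖z‖ T < 1 - ‖z‖ B` and use `T² = B² - 1`.
        have h1 : (‖z‖ * T) ^ 2 < (1 - ‖z‖ * B) ^ 2 :=
          pow_lt_pow_left₀ (by linarith) (by positivity) two_ne_zero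
        rw [mul_pow, hT2] at h1
        change 2 * ‖z‖ * B < _
        nlinarith
    exact ⟨F z, hFz, (hinj z (by simpa using hz1) hFz).symm⟩
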